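/- Let $M\cong\mathbb Z^d$ be a lattice in the $d$-dimensional real vector space $M_{\mathbb R}=M\otimes_{\mathbb Z}\mathbb R$, and let $N=\mathrm{Hom}(M,\mathbb Z)$ be the dual lattice in the dual space $N_{\mathbb R}$. A polytope (the convex hull of finitely many points) is a lattice polytope if all its vertices are lattice points. A polytope $P\subseteq M_{\mathbb R}$ is called reflexive if it is a lattice polytope with $0$ in its interior, all its vertices are primitive lattice points (nonzero, and not proper integer multiples of lattice points), and its dual polytope $P^*=\{y\in N_{\mathbb R} : \langle x,y\rangle\ge -1 \text{ for all } x\in P\}$ is a lattice polytope with respect to $N$. It is called simplicial if every facet of $P$ is a simplex, and centrally symmetric if $P=-P$. Two lattice polytopes are isomorphic ($\cong$) if an isomorphism of the lattices induces a real linear isomorphism that maps one polytope onto the other. Let $\mathcal Z_2=\mathrm{conv}([0,1]^2\cup -[0,1]^2)\subseteq\mathbb R^2$, with respect to the lattice $\mathbb Z^2$; powers of $\mathcal Z_2$ and products with $[-1,1]\subseteq\mathbb R$ are taken with respect to the product lattices. **Theorem.** Let $P\subseteq M_{\mathbb R}$ be a centrally symmetric simplicial reflexive polytope of dimension $d$,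 and let $\mathcal V(P)$ be its set of vertices. 1. If $d$ is even, then $|\mathcal V(P)|\le 3d$, with equality if and only if $P^*\cong(\mathcal Z_2)^{d/2}$. 2. If $d$ is odd, then $|\mathcal V(P)|\le 3d-1$, with equality if and only if $P^*\cong[-1,1]\times(\mathcal Z_2)^{(d-1)/2}$. -/

import Mathlib

namespace LatticePolytope

open Module

section Basic

variable {V W : Type*} [AddCommGroup V] [Module ℝ V] [AddCommGroup W] [Module ℝ W]

/-- A polytope is the convex hull of finitely many points. -/
def IsPolytope (P : Set V) : Prop :=
  ∃ S : Finset V, P = convexHull ℝ (S : Set V)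

/-- The set of vertices of a polytope, that is, its set of extreme points. -/
def vertices (P : Set V) : Set V := P.extremePoints ℝ

/-- A lattice polytope (with respect to the lattice `L`) is a polytope all of whose vertices
are lattice points. -/
def IsLatticePolytope (L : Submodule ℤ V) (P : Set V) : Prop :=
  IsPolytope P ∧ vertices P ⊆ (L : Set V)

/-- A primitive lattice point: a nonzero lattice point that is not a proper integral multiple
of another lattice point. -/
def IsPrimitive (L : Submodule ℤ V) (v : V) : Prop :=
  v ∈ L ∧ v ≠ 0 ∧ ∀ w ∈ L, ∀ k : ℤ, v = k • w → k = 1 ∨ k = -1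

/-- The dual lattice `N` of `L`, inside the dual vector space: the linear forms taking integral
values on `L`. -/
def dualLattice (L : Submodule ℤ V) : Submodule ℤ (Dual ℝ V) where
  carrier := {y | ∀ x ∈ L, ∃ n : ℤ, y x = n}
  zero_mem' := fun _ _ => ⟨0, by simp⟩
  add_mem' := by
    intro y z hy hz x hx
    obtain ⟨a, ha⟩ := hy x hx
    obtain ⟨b, hb⟩ := hz x hx
    exact ⟨a + b, by simp [ha, hb]⟩
  smul_mem' := by
    intro k y hy x hx
    obtain ⟨a, ha⟩ := hy x hx
    exact ⟨k * a, by simp [ha]⟩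

/-- The dual polytope `P* = {y | ⟨x, y⟩ ≥ -1 for all x ∈ P}`, inside the dual vector space. -/
def dualPolytope (P : Set V) : Set (Dual ℝ V) :=
  {y | ∀ x ∈ P, -1 ≤ y x}

/-- A simplex: the convex hull of a nonempty finite affinely independent set. -/
def IsSimplex (F : Set V) : Prop :=
  ∃ S : Finset V, S.Nonempty ∧ AffineIndependent ℝ (fun x : S => (x : V)) ∧
    F = convexHull ℝ (S : Set V)

/-- Central symmetry (about the origin). -/
def IsCentrallySymmetric (P : Set V) : Prop := ∀ x ∈ P, -x ∈ P

/-- `(L, P) ≅ (L', P')`: there is an isomorphism of the ambient real vector spaces that maps the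
lattice `L` onto the lattice `L'` and the polytope `P` onto the polytope `P'`. -/
def Isomorphic (L : Submodule ℤ V) (P : Set V) (L' : Submodule ℤ W) (P' : Set W) : Prop :=
  ∃ e : V ≃ₗ[ℝ] W, e '' (L : Set V) = (L' : Set W) ∧ e '' P = P'

end Basic

section Topological

variable {V : Type*} [NormedAddCommGroup V] [NormedSpace ℝ V]

/-- A facet of a full-dimensional polytope `P`: a nonempty (exposed) face of codimension one. -/
def IsFacet (P F : Set V) : Prop :=
  IsExposed ℝ P F ∧ F.Nonempty ∧ finrank ℝ (vectorSpan ℝ F) + 1 = finrank ℝ V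

/-- A polytope is simplicial if every facet is a simplex. -/
def IsSimplicial (P : Set V) : Prop := ∀ F, IsFacet P F → IsSimplex F

/-- A Fano polytope: a lattice polytope containing the origin in its interior, all of whose
vertices are primitive lattice points. -/
def IsFano (L : Submodule ℤ V) (P : Set V) : Prop :=
  IsLatticePolytope L P ∧ (0 : V) ∈ interior P ∧ ∀ v ∈ vertices P, IsPrimitive L v

/-- A reflexive polytope: a Fano polytope whose dual is a lattice polytope with respect to the
dual lattice. -/
def IsReflexive (L : Submodule ℤ V) (P : Set V) : Prop :=
  IsFano L P ∧ IsLatticePolytope (dualLattice L) (dualPolytope P)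

end Topological

/-- The lattice `ℤ` in `ℝ`. -/
def intLattice : Submodule ℤ ℝ := Submodule.span ℤ {1}

/-- The lattice `ℤ²` in `ℝ²`. -/
def planeLattice : Submodule ℤ (Fin 2 → ℝ) := Submodule.pi Set.univ fun _ => intLattice

/-- The hexagon `Z₂ = conv([0,1]² ∪ -[0,1]²)` in `ℝ²`. -/
def hexagon : Set (Fin 2 → ℝ) := convexHull ℝ (Set.Icc 0 1 ∪ Set.Icc (-1) 0)

/-- The lattice `(ℤ²)ᵏ` in `(ℝ²)ᵏ`. -/
def planeLatticePow (k : ℕ) : Submodule ℤ (Fin k → Fin 2 → ℝ) :=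
  Submodule.pi Set.univ fun _ => planeLattice

/-- The `k`-fold product `(Z₂)ᵏ` in `(ℝ²)ᵏ`. -/
def hexagonPow (k : ℕ) : Set (Fin k → Fin 2 → ℝ) := Set.univ.pi fun _ => hexagon

end LatticePolytope

/-! Fix a vertex `u` of `P*`, that is, a facet of `P` on which `u = 1`. As `P` is simplicial, the
vertices `b i` of this facet form a basis of `V`. Symmetry bounds `u` by `-1` and `1` on the
vertices of `P`, and reflexivity makes its values integers, so they are `1`, `0` or `-1`. Exactly
`d` vertices lie at height `1` and `d` at height `-1`, and it remains to bound the equator `u = 0`.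

Crossing the ridge opposite to `b i` leads to an adjacent facet `u + c • b.coord i` with `c < 0`,
which has only one new vertex (`exists_adjacent`). An equator vertex with negative `i`-th coordinate
is positive on this form, hence has value `1` there and is that new vertex (`coord_neg`). So
distinct equator vertices have disjoint negative supports. These are nonempty because the
coordinates of an equator vertex sum to `0`. Hence the equator has at most `d` elements, and an even
number of them by symmetry.

If the equator has at least `d - 1` elements, every negative support is a singleton, so every
equator vertex has the form `b j - b i`. The pairs `i, j` define an involution `σ` with at most one
fixed point, and the `b.coord i` lie in the dual lattice (`exists_involution`). In the coordinates
`y ↦ y (b j)`, `P*` is then a product of one hexagon per swapped pair and one segment per fixed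
point. Conversely, such a `P*` determines `P` by biduality, and the vertices can be counted. -/

namespace LatticePolytope

open Module

/-! ### Vertices of the polar and adjacent facets. -/

section Polar

variable {V : Type*} [AddCommGroup V] [Module ℝ V]

/-- The polar `{y | ⟨x, y⟩ ≤ 1 for all x ∈ A}` of a set. -/
def polar (A : Set V) : Set (Dual ℝ V) := {y | ∀ x ∈ A, y x ≤ 1}

/-- The points of `A` where the linear form `u` takes the value `1`. -/
def tightSet (A : Set V) (u : Dual ℝ V) : Set V := {v ∈ A | u v = 1}

/-- Otherwise a nonzero form `y` vanishes on the tight points. The finitely many other constraints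
are slack, so `u ± ε • y` stay in the polar for small `ε`, and `u` is not extreme. -/
theorem span_tightSet_of_mem_extremePoints [FiniteDimensional ℝ V] {S : Set V} (hS : S.Finite)
    {u : Dual ℝ V} (hu : u ∈ (polar S).extremePoints ℝ) :
    Submodule.span ℝ (tightSet S u) = ⊤ := by
  by_contra hne
  obtain ⟨y, hy0, hy⟩ := Submodule.exists_le_ker_of_lt_top _ (lt_top_iff_ne_top.mpr hne)
  have hyt : ∀ v ∈ tightSet S u, y v = 0 := fun v hv => hy (Submodule.subset_span hv)
  have huS : ∀ v ∈ S, u v ≤ 1 := hu.1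
  have key : ∃ ε : ℝ, 0 < ε ∧ ∀ v ∈ S, ε * |y v| ≤ 1 - u v := by
    have : ∀ᶠ ε : ℝ in nhdsWithin 0 (Set.Ioi 0), ∀ v ∈ S, ε * |y v| ≤ 1 - u v := by
      rw [Filter.eventually_all_finite hS]
      intro v hv
      rcases eq_or_lt_of_le (huS v hv) with h | h
      · have := hyt v ⟨hv, h⟩
        simp [this, h]
      · have ht : Filter.Tendsto (fun ε : ℝ => ε * |y v|) (nhdsWithin 0 (Set.Ioi 0)) (nhds 0) := by
          have : Filter.Tendsto (fun ε : ℝ => ε * |y v|) (nhds 0) (nhds (0 * |y v|)) :=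
            (continuous_id.mul continuous_const).tendsto 0
          rw [zero_mul] at this
          exact this.mono_left nhdsWithin_le_nhds
        exact (ht.eventually (gt_mem_nhds (sub_pos.mpr h))).mono fun _ h => le_of_lt h
    obtain ⟨ε, hε, hpos⟩ := (this.and self_mem_nhdsWithin).exists
    exact ⟨ε, hpos, hε⟩
  obtain ⟨ε, hε, h⟩ := key
  have habs : ∀ v, ε * y v ≤ ε * |y v| ∧ -(ε * y v) ≤ ε * |y v| := fun v =>
    ⟨mul_le_mul_of_nonneg_left (le_abs_self _) hε.le, by
      rw [← mul_neg]; exact mul_le_mul_of_nonneg_left (neg_le_abs _) hε.le⟩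
  have h1 : u + ε • y ∈ polar S := fun v hv => by
    have := h v hv; have := (habs v).1
    simp only [LinearMap.add_apply, LinearMap.smul_apply, smul_eq_mul]; linarith
  have h2 : u - ε • y ∈ polar S := fun v hv => by
    have := h v hv; have := (habs v).2
    simp only [LinearMap.sub_apply, LinearMap.smul_apply, smul_eq_mul]; linarith
  have hmem : u ∈ openSegment ℝ (u + ε • y) (u - ε • y) :=
    ⟨1 / 2, 1 / 2, by norm_num, by norm_num, by norm_num, by module⟩
  have := (mem_extremePoints_iff_left.mp hu).2 _ h1 _ h2 hmem
  have h0 : ε • y = 0 := by simpa using this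
  rcases smul_eq_zero.mp h0 with h | h
  · exact hε.ne' h
  · exact hy0 h

/-- If a proper convex combination of two numbers at most `1` equals `1`, both are `1`. So the
endpoints of a segment through `u` agree with `u` on a spanning set. -/
theorem mem_extremePoints_of_span_tightSet {S : Set V} {u : Dual ℝ V} (hu : u ∈ polar S)
    (h : Submodule.span ℝ (tightSet S u) = ⊤) : u ∈ (polar S).extremePoints ℝ := by
  refine mem_extremePoints_iff_left.mpr ⟨hu, fun p hp q hq hpq => ?_⟩
  obtain ⟨a, b, ha, hb, hab, rfl⟩ := hpq
  refine LinearMap.ext_on h fun v hv => ?_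
  have h1 : a * p v + b * q v = 1 := hv.2
  have h2 := hp v hv.1
  have h3 := hq v hv.1
  have h4 : a * (1 - p v) + b * (1 - q v) = 0 := by linarith
  have h5 : 0 ≤ b * (1 - q v) := mul_nonneg hb.le (by linarith)
  have h6 : 0 ≤ a * (1 - p v) := mul_nonneg ha.le (by linarith)
  have h7 : a * (1 - p v) = 0 := by linarith
  rcases mul_eq_zero.mp h7 with h8 | h8
  · exact absurd h8 ha.ne'
  · rw [hv.2]; linarith

/-- The combinatorial data of the vertex set `S` of a centrally symmetric simplicial reflexive
polytope, with dual lattice `N`. -/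
structure IsReflexiveVertexSet (S : Finset V) (N : Submodule ℤ (Dual ℝ V)) : Prop where
  neg_mem : ∀ v ∈ S, -v ∈ S
  zero_notMem : (0 : V) ∉ S
  extreme_mem : ∀ u ∈ (polar (S : Set V)).extremePoints ℝ, u ∈ N
  integral : ∀ y ∈ N, ∀ v ∈ S, ∃ n : ℤ, y v = n
  linearIndepOn : ∀ u ∈ (polar (S : Set V)).extremePoints ℝ,
    LinearIndepOn ℝ id (tightSet (S : Set V) u)

variable {S : Finset V} {N : Submodule ℤ (Dual ℝ V)}

theorem IsReflexiveVertexSet.exists_basis [FiniteDimensional ℝ V] (h : IsReflexiveVertexSet S N)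
    {u : Dual ℝ V} (hu : u ∈ (polar (S : Set V)).extremePoints ℝ) :
    ∃ b : Basis (tightSet (S : Set V) u) ℝ V, ∀ i, b i = i := by
  have hli : LinearIndependent ℝ fun i : tightSet (S : Set V) u => (i : V) :=
    h.linearIndepOn u hu
  refine ⟨Basis.mk (v := fun i : tightSet (S : Set V) u => (i : V)) hli ?_,
    fun i => Basis.mk_apply _ _ i⟩
  rw [Subtype.range_coe, span_tightSet_of_mem_extremePoints S.finite_toSet hu]

theorem IsReflexiveVertexSet.value_cases (h : IsReflexiveVertexSet S N)
    {u : Dual ℝ V} (hu : u ∈ (polar (S : Set V)).extremePoints ℝ) {v : V} (hv : v ∈ S) :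
    u v = 1 ∨ u v = 0 ∨ u v = -1 := by
  obtain ⟨n, hn⟩ := h.integral u (h.extreme_mem u hu) v hv
  have h1 : u v ≤ 1 := hu.1 v hv
  have h2 : u (-v) ≤ 1 := hu.1 (-v) (h.neg_mem v hv)
  rw [map_neg, hn] at h2
  rw [hn] at h1
  have h3 : n ≤ 1 := by exact_mod_cast h1
  have h4 : -1 ≤ n := by
    have : (-1 : ℝ) ≤ n := by linarith
    exact_mod_cast this
  have : n = 1 ∨ n = 0 ∨ n = -1 := by omega
  rcases this with rfl | rfl | rfl <;> simp [hn]

variable {ι : Type*} [Fintype ι] {u : Dual ℝ V} {b : Basis ι ℝ V}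

/-- Passing to the adjacent facet across the ridge opposite to `b i`. -/
theorem IsReflexiveVertexSet.exists_adjacent (h : IsReflexiveVertexSet S N)
    (hu : u ∈ polar (S : Set V)) (hb : Set.range b = tightSet (S : Set V) u) (i : ι) :
    ∃ c < (0 : ℝ), ∃ w ∈ S, u + c • b.coord i ∈ (polar (S : Set V)).extremePoints ℝ ∧
      ∀ v ∈ S, (u + c • b.coord i) v = 1 → u v = 1 ∨ v = w := by
  classical
  have hbm : ∀ j, b j ∈ S ∧ u (b j) = 1 := fun j => by
    have : b j ∈ tightSet (S : Set V) u := hb ▸ Set.mem_range_self j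
    exact this
  set A := S.filter fun v => b.coord i v < 0 with hA
  have hAne : A.Nonempty := ⟨-b i, by simp [hA, h.neg_mem _ (hbm i).1]⟩
  -- The ratio test: `u - t • b.coord i` stays in the polar as `t` grows from `0` until the first
  -- constraint with negative `i`-th coordinate becomes tight.
  obtain ⟨w, hwA, hw⟩ := A.exists_min_image (fun v => (1 - u v) / (-b.coord i v)) hAne
  obtain ⟨hwS, hwi⟩ := Finset.mem_filter.mp hwA
  set r := (1 - u w) / (-b.coord i w) with hr
  have huw : u w < 1 := lt_of_le_of_ne (hu w hwS) fun heq => by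
    have : w ∈ Set.range b := hb ▸ ⟨hwS, heq⟩
    obtain ⟨j, rfl⟩ := this
    rw [Basis.coord_apply, Basis.repr_self, Finsupp.single_apply] at hwi
    split_ifs at hwi <;> linarith
  have hr0 : 0 < r := div_pos (by linarith) (by linarith)
  set u' := u + (-r) • b.coord i with hu'
  have hu'v : ∀ v, u' v = u v - r * b.coord i v := fun v => by
    simp only [hu', LinearMap.add_apply, LinearMap.smul_apply, smul_eq_mul]; ring
  have hu'P : u' ∈ polar (S : Set V) := fun v hv => by
    rw [hu'v]
    rcases lt_or_ge (b.coord i v) 0 with hneg | hpos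
    · have := hw v (Finset.mem_filter.mpr ⟨hv, hneg⟩)
      rw [le_div_iff₀ (by linarith)] at this
      linarith
    · have := hu v hv
      have := mul_nonneg hr0.le hpos
      linarith
  have hu'w : u' w = 1 := by
    have : b.coord i w ≠ 0 := hwi.ne
    rw [hu'v, hr]; field_simp; ring
  set Q : Set V := insert w (b '' {j | j ≠ i}) with hQ
  have hQt : Q ⊆ tightSet (S : Set V) u' := by
    rintro v (rfl | ⟨j, hj, rfl⟩)
    · exact ⟨hwS, hu'w⟩
    · refine ⟨(hbm j).1, ?_⟩
      rw [hu'v, (hbm j).2]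
      simp [show j ≠ i from hj]
  have hQspan : Submodule.span ℝ Q = ⊤ := by
    rw [eq_top_iff, ← b.span_eq, Submodule.span_le]
    have hj : ∀ j, j ≠ i → b j ∈ Submodule.span ℝ Q := fun j hj =>
      Submodule.subset_span (Or.inr ⟨j, hj, rfl⟩)
    rintro _ ⟨j, rfl⟩
    by_cases hji : j = i
    · subst hji
      have hwsum := b.sum_repr w
      rw [← Finset.add_sum_erase _ _ (Finset.mem_univ j)] at hwsum
      have hmem : b.repr w j • b j ∈ Submodule.span ℝ Q := by
        rw [eq_sub_of_add_eq hwsum]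
        refine Submodule.sub_mem _ (Submodule.subset_span (Or.inl rfl)) ?_
        exact Submodule.sum_mem _ fun k hk =>
          Submodule.smul_mem _ _ (hj k (Finset.ne_of_mem_erase hk))
      exact (Submodule.smul_mem_iff _ hwi.ne).mp hmem
    · exact hj j hji
  have hu'E := mem_extremePoints_of_span_tightSet hu'P
    (eq_top_iff.mpr (hQspan ▸ Submodule.span_mono hQt))
  refine ⟨-r, by linarith, w, hwS, hu'E, fun v hv hv1 => ?_⟩
  by_contra hcon
  push Not at hcon
  have hvQ : v ∉ Q := by
    rintro (rfl | ⟨j, hj, rfl⟩)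
    · exact hcon.2 rfl
    · exact hcon.1 (hbm j).2
  -- The tight set of `u'` is linearly independent and its subset `Q` already spans, so no further
  -- vertex can be tight.
  have := linearIndepOn_iff_notMem_span.mp (h.linearIndepOn u' hu'E) v ⟨hv, hv1⟩
  apply this
  have hsub : Q ⊆ id '' (tightSet (S : Set V) u' \ {v}) := by
    rw [Set.image_id]
    exact fun q hq => ⟨hQt hq, fun hqv => hvQ (hqv ▸ hq)⟩
  have := Submodule.span_mono (R := ℝ) hsub
  rw [hQspan] at this
  exact this trivial

/-- The adjacent form has value `c * b.coord i v > 0` at `v`. Its only possible positive value is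
`1`, so `v` is the unique new vertex of the adjacent facet. -/
theorem IsReflexiveVertexSet.coord_neg (h : IsReflexiveVertexSet S N)
    (hu : u ∈ polar (S : Set V)) (hb : Set.range b = tightSet (S : Set V) u) (i : ι) :
    ∃ w, ∀ v ∈ S, u v = 0 → b.coord i v < 0 →
      v = w ∧ b.coord i v = -1 ∧ u - b.coord i ∈ (polar (S : Set V)).extremePoints ℝ := by
  obtain ⟨c, hc, w, hw, hE, huniq⟩ := h.exists_adjacent hu hb i
  refine ⟨w, fun v hv hv0 hneg => ?_⟩
  have hbi : b i ∈ S ∧ u (b i) = 1 := by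
    have : b i ∈ tightSet (S : Set V) u := hb ▸ Set.mem_range_self i
    exact this
  have hval : ∀ x, (u + c • b.coord i) x = u x + c * b.coord i x := fun x => rfl
  have hpos : 0 < c * b.coord i v := mul_pos_of_neg_of_neg hc hneg
  have hv1 : (u + c • b.coord i) v = 1 := by
    rcases h.value_cases hE hv with h1 | h1 | h1
    · exact h1
    all_goals rw [hval, hv0] at h1; linarith
  have hvw : v = w := (huniq v hv hv1).resolve_left (by rw [hv0]; norm_num)
  -- The value `1 + c` at `b i` leaves only `c = -1` and `c = -2`. In the second case `-b i` is
  -- tight, hence equal to `w = v`, although `u` is `-1` at `-b i` and `0` at `v`.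
  have hc1 : c = -1 := by
    have hii : (u + c • b.coord i) (b i) = 1 + c := by rw [hval, hbi.2]; simp
    rcases h.value_cases hE hbi.1 with h1 | h1 | h1
    · rw [hii] at h1; linarith
    · rw [hii] at h1; linarith
    · have h2 : (u + c • b.coord i) (-b i) = 1 := by rw [map_neg, h1]; norm_num
      have h3 := (huniq _ (h.neg_mem _ hbi.1) h2).resolve_left (by
        rw [map_neg, hbi.2]; norm_num)
      rw [hvw, ← h3, map_neg, hbi.2] at hv0
      norm_num at hv0
  subst hc1
  rw [hval, hv0] at hv1
  refine ⟨hvw, by linarith, ?_⟩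
  rwa [show u + (-1 : ℝ) • b.coord i = u - b.coord i by module] at hE

end Polar

/-! ### Counting the equator by negative supports. -/

section Combinatorics

variable {V : Type*} [AddCommGroup V] [Module ℝ V] {S : Finset V} {N : Submodule ℤ (Dual ℝ V)}
  {ι : Type*} [Fintype ι] {u : Dual ℝ V} {b : Basis ι ℝ V}

/-- The indices of the negative coordinates of `v`. -/
noncomputable def negSupport (b : Basis ι ℝ V) (v : V) : Finset ι :=
  Finset.univ.filter fun i => b.coord i v < 0

/-- The elements of `S` on the hyperplane `u = 0`. -/
noncomputable def equator (S : Finset V) (u : Dual ℝ V) : Finset V := S.filter fun v => u v = 0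

theorem mem_negSupport {v : V} {i : ι} : i ∈ negSupport b v ↔ b.coord i v < 0 := by
  simp [negSupport]

theorem mem_equator {v : V} : v ∈ equator S u ↔ v ∈ S ∧ u v = 0 := by
  simp [equator]

theorem basis_mem_of_range_eq {ι : Type*} {b : Basis ι ℝ V}
    (hb : Set.range b = tightSet (S : Set V) u) (j : ι) :
    b j ∈ S ∧ u (b j) = 1 := by
  have : b j ∈ tightSet (S : Set V) u := hb ▸ Set.mem_range_self j
  exact this

theorem eq_sum_coord (hb : Set.range b = tightSet (S : Set V) u) : u = ∑ i, b.coord i := by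
  classical
  refine b.ext fun j => ?_
  simp [(basis_mem_of_range_eq hb j).2, LinearMap.sum_apply, Finsupp.single_apply]

namespace IsReflexiveVertexSet

theorem neg_mem_equator (h : IsReflexiveVertexSet S N) {v : V} (hv : v ∈ equator S u) :
    -v ∈ equator S u := by
  rw [mem_equator] at *
  exact ⟨h.neg_mem v hv.1, by simp [hv.2]⟩

/-- `coord_neg` applied to `v` and to `-v` shows that all coordinates are `-1`, `0` or `1`. -/
theorem coord_eq (h : IsReflexiveVertexSet S N)
    (hu : u ∈ polar (S : Set V)) (hb : Set.range b = tightSet (S : Set V) u)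
    {v : V} (hv : v ∈ equator S u) (i : ι) :
    b.coord i v = (if b.coord i (-v) < 0 then 1 else 0) - (if b.coord i v < 0 then 1 else 0) := by
  obtain ⟨w, hw⟩ := h.coord_neg hu hb i
  obtain ⟨hv1, hv2⟩ := mem_equator.mp hv
  obtain ⟨hn1, hn2⟩ := mem_equator.mp (h.neg_mem_equator hv)
  have h1 := hw v hv1 hv2
  have h2 := hw (-v) hn1 hn2
  rw [map_neg] at h2 ⊢
  rcases lt_trichotomy (b.coord i v) 0 with hc | hc | hc
  · rw [if_neg (by linarith), if_pos hc, (h1 hc).2.1]; norm_num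
  · simp [hc]
  · rw [if_pos (by linarith), if_neg (by linarith)]
    have := (h2 (by linarith)).2.1
    linarith

/-- The coordinates of `v` sum to `u v = 0`, so the entries `1` and `-1` are equally many. -/
theorem card_negSupport_neg (h : IsReflexiveVertexSet S N)
    (hu : u ∈ polar (S : Set V)) (hb : Set.range b = tightSet (S : Set V) u)
    {v : V} (hv : v ∈ equator S u) :
    (negSupport b (-v)).card = (negSupport b v).card := by
  have h0 : ∑ i, b.coord i v = 0 := by
    rw [← LinearMap.sum_apply, ← eq_sum_coord hb, (mem_equator.mp hv).2]
  rw [Finset.sum_congr rfl fun i _ => h.coord_eq hu hb hv i, Finset.sum_sub_distrib,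
    Finset.sum_boole, Finset.sum_boole, sub_eq_zero] at h0
  exact_mod_cast h0

theorem negSupport_nonempty (h : IsReflexiveVertexSet S N)
    (hu : u ∈ polar (S : Set V)) (hb : Set.range b = tightSet (S : Set V) u)
    {v : V} (hv : v ∈ equator S u) : (negSupport b v).Nonempty := by
  rw [Finset.nonempty_iff_ne_empty]
  intro he
  have he' : negSupport b (-v) = ∅ := by
    rw [← Finset.card_eq_zero, h.card_negSupport_neg hu hb hv, he, Finset.card_empty]
  have : v = 0 := b.ext_elem fun i => by
    have h1 : i ∉ negSupport b v := by simp [he]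
    have h2 : i ∉ negSupport b (-v) := by simp [he']
    rw [mem_negSupport] at h1 h2
    have := h.coord_eq hu hb hv i
    rw [if_neg h1, if_neg h2] at this
    simpa using this
  exact h.zero_notMem (this ▸ (mem_equator.mp hv).1)

theorem eq_of_mem_negSupport (h : IsReflexiveVertexSet S N)
    (hu : u ∈ polar (S : Set V)) (hb : Set.range b = tightSet (S : Set V) u)
    {v w : V} (hv : v ∈ equator S u) (hw : w ∈ equator S u) {i : ι}
    (hiv : i ∈ negSupport b v) (hiw : i ∈ negSupport b w) : v = w := by
  obtain ⟨x, hx⟩ := h.coord_neg hu hb i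
  rw [mem_equator] at hv hw
  rw [(hx v hv.1 hv.2 (mem_negSupport.mp hiv)).1, (hx w hw.1 hw.2 (mem_negSupport.mp hiw)).1]

theorem sum_card_negSupport_le (h : IsReflexiveVertexSet S N)
    (hu : u ∈ polar (S : Set V)) (hb : Set.range b = tightSet (S : Set V) u) :
    ∑ v ∈ equator S u, (negSupport b v).card ≤ Fintype.card ι := by
  classical
  rw [← Finset.card_biUnion]
  · exact Finset.card_le_univ _
  · intro v hv w hw hvw
    exact Finset.disjoint_left.mpr fun i hiv hiw => hvw (h.eq_of_mem_negSupport hu hb hv hw hiv hiw)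

theorem card_equator_le (h : IsReflexiveVertexSet S N)
    (hu : u ∈ polar (S : Set V)) (hb : Set.range b = tightSet (S : Set V) u) :
    (equator S u).card ≤ Fintype.card ι := by
  refine le_trans ?_ (h.sum_card_negSupport_le hu hb)
  rw [Finset.card_eq_sum_ones]
  exact Finset.sum_le_sum fun v hv => (h.negSupport_nonempty hu hb hv).card_pos

theorem ne_neg_of_mem (h : IsReflexiveVertexSet S N) {v : V} (hv : v ∈ S) : -v ≠ v := by
  intro heq
  have h2 : (2 : ℝ) • v = 0 := by
    rw [two_smul]; nth_rewrite 1 [← heq]; exact neg_add_cancel v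
  have : v = 0 := (smul_eq_zero.mp h2).resolve_left two_ne_zero
  exact h.zero_notMem (this ▸ hv)

theorem even_card_equator (h : IsReflexiveVertexSet S N) (u : Dual ℝ V) :
    Even (equator S u).card := by
  -- Negation is a fixed-point-free involution of the equator; the sum of ones in `ZMod 2` records
  -- the parity.
  have : ∑ v ∈ equator S u, (1 : ZMod 2) = 0 :=
    Finset.sum_involution (fun v _ => -v) (fun _ _ => by decide)
      (fun v hv _ => h.ne_neg_of_mem (mem_equator.mp hv).1)
      (fun v hv => h.neg_mem_equator hv) (fun v _ => neg_neg v)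
  rw [Finset.sum_const, nsmul_eq_mul, mul_one, ZMod.natCast_eq_zero_iff] at this
  exact even_iff_two_dvd.mpr this

theorem card_eq (h : IsReflexiveVertexSet S N)
    (hu : u ∈ (polar (S : Set V)).extremePoints ℝ)
    (hb : Set.range b = tightSet (S : Set V) u) :
    S.card = 2 * Fintype.card ι + (equator S u).card := by
  classical
  set A := S.filter fun v => u v = 1 with hA
  set B := S.filter fun v => u v = -1 with hB
  have hAcard : A.card = Fintype.card ι := by
    rw [← Finset.card_univ, ← Finset.card_image_of_injective _ b.injective]
    congr 1
    ext v
    have : v ∈ Set.range b ↔ v ∈ tightSet (S : Set V) u := by rw [hb]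
    simp only [Set.mem_range, tightSet, Set.mem_ofPred_eq, Finset.mem_coe] at this
    simp [hA, this]
  have hBA : B.card = A.card := by
    refine Finset.card_nbij (fun v => -v) ?_ neg_injective.injOn ?_
    · intro v hv
      have hv := Finset.mem_filter.mp hv
      exact Finset.mem_filter.mpr ⟨h.neg_mem v hv.1, by rw [map_neg, hv.2, neg_neg]⟩
    · intro v hv
      have hv := Finset.mem_filter.mp hv
      exact ⟨-v, Finset.mem_filter.mpr ⟨h.neg_mem v hv.1, by rw [map_neg, hv.2]⟩, neg_neg v⟩
  have hS : S = (A ∪ B) ∪ equator S u := by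
    ext v
    simp only [hA, hB, Finset.mem_union, Finset.mem_filter, mem_equator]
    constructor
    · intro hv
      rcases h.value_cases hu hv with h1 | h1 | h1 <;> simp [hv, h1]
    · tauto
  rw [hS, Finset.card_union_of_disjoint, Finset.card_union_of_disjoint, hBA, hAcard, ← hS]
  · ring
  · rw [Finset.disjoint_left]
    intro v h1 h2
    have h1 := (Finset.mem_filter.mp h1).2
    have h2 := (Finset.mem_filter.mp h2).2
    linarith
  · rw [Finset.disjoint_left]
    intro v h1 h2
    have h2 := (mem_equator.mp h2).2
    rcases Finset.mem_union.mp h1 with h1 | h1 <;>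
    · have h1 := (Finset.mem_filter.mp h1).2
      linarith

/-- A support of size at least `2` occurs for both `v` and `-v`, so the total size would exceed the
number of equator vertices by at least two. The hypothesis `hcard` leaves room for one. -/
theorem card_negSupport_eq_one (h : IsReflexiveVertexSet S N)
    (hu : u ∈ polar (S : Set V)) (hb : Set.range b = tightSet (S : Set V) u)
    (hcard : Fintype.card ι ≤ (equator S u).card + 1) {v : V} (hv : v ∈ equator S u) :
    (negSupport b v).card = 1 := by
  classical
  by_contra hne
  have hpos : ∀ w ∈ equator S u, 1 ≤ (negSupport b w).card := fun w hw =>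
    (h.negSupport_nonempty hu hb hw).card_pos
  have hv2 : 2 ≤ (negSupport b v).card := by have := hpos v hv; omega
  have hn := h.neg_mem_equator hv
  have hsum := h.sum_card_negSupport_le hu hb
  rw [← Finset.add_sum_erase _ _ hv,
    ← Finset.add_sum_erase _ _ (Finset.mem_erase.mpr ⟨h.ne_neg_of_mem (mem_equator.mp hv).1, hn⟩),
    h.card_negSupport_neg hu hb hv] at hsum
  have hrest : ((((equator S u).erase v).erase (-v))).card ≤
      ∑ w ∈ ((equator S u).erase v).erase (-v), (negSupport b w).card := by
    rw [Finset.card_eq_sum_ones]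
    exact Finset.sum_le_sum fun w hw =>
      hpos w (Finset.mem_of_mem_erase (Finset.mem_of_mem_erase hw))
  rw [Finset.card_erase_of_mem
    (Finset.mem_erase.mpr ⟨h.ne_neg_of_mem (mem_equator.mp hv).1, hn⟩),
    Finset.card_erase_of_mem hv] at hrest
  omega

theorem exists_eq_sub (h : IsReflexiveVertexSet S N)
    (hu : u ∈ polar (S : Set V)) (hb : Set.range b = tightSet (S : Set V) u)
    (hcard : Fintype.card ι ≤ (equator S u).card + 1) {v : V} (hv : v ∈ equator S u) :
    ∃ i j, i ≠ j ∧ v = b j - b i := by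
  classical
  obtain ⟨i, hi⟩ := Finset.card_eq_one.mp (h.card_negSupport_eq_one hu hb hcard hv)
  obtain ⟨j, hj⟩ := Finset.card_eq_one.mp
    (h.card_negSupport_eq_one hu hb hcard (h.neg_mem_equator hv))
  have hi' : ∀ k, b.coord k v < 0 ↔ k = i := fun k => by
    rw [← mem_negSupport, hi, Finset.mem_singleton]
  have hj' : ∀ k, b.coord k (-v) < 0 ↔ k = j := fun k => by
    rw [← mem_negSupport, hj, Finset.mem_singleton]
  refine ⟨i, j, ?_, b.ext_elem fun k => ?_⟩
  · rintro rfl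
    have h1 := (hi' i).mpr rfl
    have h2 := (hj' i).mpr rfl
    rw [map_neg] at h2
    linarith
  · have := h.coord_eq hu hb hv k
    simp only [hi', hj'] at this
    rw [Basis.coord_apply] at this
    simp [this, Finsupp.single_apply, eq_comm]

/-- If the number of vertices is (nearly) maximal, then the vertices are `± b j` and `b j - b (σ j)`
for an involution `σ`. -/
theorem exists_involution (h : IsReflexiveVertexSet S N)
    (hu : u ∈ (polar (S : Set V)).extremePoints ℝ)
    (hb : Set.range b = tightSet (S : Set V) u)
    (hcard : Fintype.card ι ≤ (equator S u).card + 1) :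
    ∃ σ : ι → ι, Function.Involutive σ ∧ {i | σ i ≠ i}.ncard = (equator S u).card ∧
      (∀ v, v ∈ S ↔ ∃ j, v = b j ∨ v = -b j ∨ (σ j ≠ j ∧ v = b j - b (σ j))) ∧
      ∀ y, y ∈ N ↔ ∀ j, ∃ n : ℤ, y (b j) = n := by
  classical
  have hbm := basis_mem_of_range_eq hb
  have huP : u ∈ polar (S : Set V) := hu.1
  -- `R` pairs `i` with `j` when `b j - b i` is an equator vertex. Disjointness of negative supports
  -- makes it a partial matching, which `σ` extends by fixing unmatched indices.
  set R : ι → ι → Prop := fun i j => i ≠ j ∧ b j - b i ∈ S with hR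
  have hReq : ∀ {i j}, R i j → b j - b i ∈ equator S u := fun {i j} hij =>
    mem_equator.mpr ⟨hij.2, by rw [map_sub, (hbm i).2, (hbm j).2, sub_self]⟩
  have hcoord : ∀ {i j k}, i ≠ j → (b.coord k (b j - b i) < 0 ↔ k = i) := fun {i j k} hij => by
    rw [map_sub, Basis.coord_apply, Basis.coord_apply, b.repr_self, b.repr_self,
      Finsupp.single_apply, Finsupp.single_apply]
    constructor
    · intro hlt
      by_contra hki
      rw [if_neg (Ne.symm hki)] at hlt
      split_ifs at hlt <;> norm_num at hlt
    · rintro rfl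
      rw [if_neg hij.symm, if_pos rfl]; norm_num
  have hRsymm : ∀ {i j}, R i j → R j i := fun {i j} hij =>
    ⟨hij.1.symm, by rw [← neg_sub]; exact h.neg_mem _ hij.2⟩
  have hRuniq : ∀ {i j k}, R i j → R i k → j = k := fun {i j k} hij hik => by
    have := h.eq_of_mem_negSupport huP hb (hReq hij) (hReq hik)
      (mem_negSupport.mpr ((hcoord hij.1).mpr rfl)) (mem_negSupport.mpr ((hcoord hik.1).mpr rfl))
    exact b.injective (sub_left_injective this)
  set σ : ι → ι := fun i => if hi : ∃ j, R i j then hi.choose else i with hσ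
  have hσR : ∀ {i j}, R i j → σ i = j := fun {i j} hij => by
    have hi : ∃ j, R i j := ⟨j, hij⟩
    have : σ i = hi.choose := dif_pos hi
    rw [this]; exact hRuniq hi.choose_spec hij
  have hσne : ∀ {i}, σ i ≠ i → R i (σ i) := fun {i} hne => by
    by_cases hi : ∃ j, R i j
    · obtain ⟨j, hij⟩ := hi
      rw [hσR hij]; exact hij
    · exact absurd (dif_neg hi) hne
  have hinv : Function.Involutive σ := fun i => by
    by_cases hi : σ i = i
    · rw [hi, hi]
    · exact hσR (hRsymm (hσne hi))
  have hcardσ : {i | σ i ≠ i}.ncard = (equator S u).card := by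
    rw [Set.ncard_eq_toFinset_card']
    refine Finset.card_nbij (fun i => b (σ i) - b i) ?_ ?_ ?_
    · intro i hi
      exact hReq (hσne (by simpa using hi))
    · intro i hi k hk hik
      have hi : σ i ≠ i := by simpa using hi
      have hk : σ k ≠ k := by simpa using hk
      have h1 := (hcoord (k := i) hi.symm).mpr rfl
      have hik : b (σ i) - b i = b (σ k) - b k := hik
      rw [hik] at h1
      exact (hcoord hk.symm).mp h1
    · intro v hv
      obtain ⟨i, j, hij, rfl⟩ := h.exists_eq_sub huP hb hcard hv
      have hRij : R i j := ⟨hij, (mem_equator.mp hv).1⟩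
      refine ⟨i, ?_, ?_⟩
      · simp [hσR hRij, hij.symm]
      · simp [hσR hRij]
  refine ⟨σ, hinv, hcardσ, fun v => ⟨fun hv => ?_, ?_⟩, fun y => ⟨fun hy j => ?_, fun hy => ?_⟩⟩
  · rcases h.value_cases hu hv with h1 | h1 | h1
    · have : v ∈ Set.range b := hb ▸ ⟨hv, h1⟩
      obtain ⟨j, rfl⟩ := this
      exact ⟨j, Or.inl rfl⟩
    · obtain ⟨i, j, hij, rfl⟩ := h.exists_eq_sub huP hb hcard (mem_equator.mpr ⟨hv, h1⟩)
      have : σ j = i := hσR (hRsymm ⟨hij, hv⟩)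
      exact ⟨j, Or.inr (Or.inr (by rw [this]; exact ⟨hij, rfl⟩))⟩
    · have : -v ∈ Set.range b := hb ▸ ⟨h.neg_mem v hv, by rw [map_neg, h1, neg_neg]⟩
      obtain ⟨j, hj⟩ := this
      exact ⟨j, Or.inr (Or.inl (by rw [hj, neg_neg]))⟩
  · rintro ⟨j, rfl | rfl | ⟨hj, rfl⟩⟩
    · exact (hbm j).1
    · exact h.neg_mem _ (hbm j).1
    · exact (hRsymm (hσne hj)).2
  · exact h.integral y hy _ (hbm j).1
  -- For a moved index, `u` and `u - b.coord i` are both vertices of the polar, so their difference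
  -- `b.coord i` lies in `N`.
  · have huN := h.extreme_mem u hu
    have hmoved : ∀ i, σ i ≠ i → b.coord i ∈ N := fun i hi => by
      have hv := hReq (hσne hi)
      obtain ⟨w, hw⟩ := h.coord_neg huP hb i
      have := (hw _ (mem_equator.mp hv).1 (mem_equator.mp hv).2
        ((hcoord (hσne hi).1).mpr rfl)).2.2
      have := N.sub_mem huN (h.extreme_mem _ this)
      rwa [sub_sub_cancel] at this
    have hall : ∀ i, b.coord i ∈ N := fun i => by
      by_cases hi : σ i = i
      -- By `hcard` at most one index is fixed; its coordinate form is `u` minus all the others.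
      · have hother : ∀ j, j ≠ i → σ j ≠ j := fun j hj hσj => by
          have hsub : {i | σ i ≠ i} ⊆ ((Finset.univ.erase i).erase j : Finset ι) := fun k hk => by
            have hk : σ k ≠ k := hk
            simp only [Finset.coe_erase, Set.mem_sdiff, Set.mem_singleton_iff, Finset.coe_univ,
              Set.mem_univ, true_and]
            exact ⟨fun hki => hk (hki ▸ hi), fun hkj => hk (hkj ▸ hσj)⟩
          have hle := Set.ncard_le_ncard hsub (Finset.finite_toSet _)
          rw [Set.ncard_coe_finset, hcardσ, Finset.card_erase_of_mem (by simp [hj]),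
            Finset.card_erase_of_mem (Finset.mem_univ _), Finset.card_univ] at hle
          have : 1 < Fintype.card ι := Fintype.one_lt_card_iff.mpr ⟨j, i, hj⟩
          omega
        have := eq_sum_coord hb
        rw [← Finset.add_sum_erase _ _ (Finset.mem_univ i)] at this
        rw [eq_sub_of_add_eq this.symm]
        exact N.sub_mem huN (N.sum_mem fun j hj => hmoved j (hother j (Finset.ne_of_mem_erase hj)))
      · exact hmoved i hi
    choose n hn using hy
    have : y = ∑ j, n j • b.coord j := b.ext fun j => by
      simp [hn, LinearMap.sum_apply, Finsupp.single_apply]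
    rw [this]
    exact N.sum_mem fun j _ => N.smul_mem _ (hall j)

end IsReflexiveVertexSet

end Combinatorics

/-! ### From polytopes to the combinatorial data. -/

section Geometry

variable {V : Type*} [NormedAddCommGroup V] [NormedSpace ℝ V]

/-- Half of the bipolar theorem: a hyperplane separating a point of `B` from `A` can be scaled to
level `1`, since `0 ∈ A` makes its level positive. -/
theorem subset_of_polar_subset {A B : Set V} (hA : Convex ℝ A) (hA' : IsClosed A)
    (h0 : (0 : V) ∈ A) (h : polar A ⊆ polar B) : B ⊆ A := by
  intro x hx
  by_contra hxA
  obtain ⟨f, c, hf, hc⟩ := geometric_hahn_banach_closed_point hA hA' hxA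
  have hc0 : 0 < c := by simpa using hf 0 h0
  have hmem : c⁻¹ • (f : V →ₗ[ℝ] ℝ) ∈ polar A := fun a ha => by
    have := hf a ha
    simp only [LinearMap.smul_apply, ContinuousLinearMap.coe_coe, smul_eq_mul]
    rw [inv_mul_le_iff₀ hc0]; linarith
  have := h hmem x hx
  simp only [LinearMap.smul_apply, ContinuousLinearMap.coe_coe, smul_eq_mul] at this
  rw [inv_mul_le_iff₀ hc0] at this
  linarith

theorem polar_convexHull {V : Type*} [AddCommGroup V] [Module ℝ V] (A : Set V) :
    polar (convexHull ℝ A) = polar A := by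
  ext y
  refine ⟨fun h x hx => h x (subset_convexHull ℝ A hx), fun h x hx => ?_⟩
  have : convexHull ℝ A ⊆ {x | y x ≤ 1} :=
    convexHull_min h (convex_halfSpace_le y.isLinear 1)
  exact this hx

theorem dualPolytope_eq_polar {V : Type*} [AddCommGroup V] [Module ℝ V] {P : Set V}
    (hP : IsCentrallySymmetric P) : dualPolytope P = polar P := by
  ext y
  constructor
  · intro h x hx
    have := h (-x) (hP x hx)
    rw [map_neg] at this; linarith
  · intro h x hx
    have := h (-x) (hP x hx)
    rw [map_neg] at this; linarith

theorem isClosed_of_isPolytope {P : Set V} (hP : IsPolytope P) : IsClosed P := by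
  obtain ⟨A, rfl⟩ := hP
  exact (A.finite_toSet.isCompact_convexHull (𝕜 := ℝ)).isClosed

theorem finite_vertices {V : Type*} [AddCommGroup V] [Module ℝ V] {P : Set V}
    (hP : IsPolytope P) : (vertices P).Finite := by
  obtain ⟨A, rfl⟩ := hP
  exact A.finite_toSet.subset extremePoints_convexHull_subset

theorem convexHull_vertices {P : Set V} (hP : IsPolytope P) : convexHull ℝ (vertices P) = P := by
  have hfin := finite_vertices hP
  obtain ⟨A, rfl⟩ := hP
  have := closure_convexHull_extremePoints (A.finite_toSet.isCompact_convexHull (𝕜 := ℝ))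
    (convex_convexHull ℝ _)
  exact (hfin.isCompact_convexHull (𝕜 := ℝ)).isClosed.closure_eq.symm.trans this

theorem neg_mem_vertices {V : Type*} [AddCommGroup V] [Module ℝ V] {P : Set V}
    (hP : IsCentrallySymmetric P) {v : V} (hv : v ∈ vertices P) : -v ∈ vertices P := by
  have hv := mem_extremePoints_iff_left.mp hv
  refine mem_extremePoints_iff_left.mpr ⟨hP v hv.1, fun x hx y hy hxy => ?_⟩
  obtain ⟨a, c, ha, hc, hac, hs⟩ := hxy
  have := hv.2 (-x) (hP x hx) (-y) (hP y hy) ⟨a, c, ha, hc, hac, by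
    rw [smul_neg, smul_neg, ← neg_add, hs, neg_neg]⟩
  rw [← this, neg_neg]

/-- The face `u = 1` is a facet because its vertices span `V`, hence it is a simplex, and the tight
vertices are affinely independent. Applying `u` to a linear relation among them shows that its
coefficients sum to `0`, so affine independence gives linear independence. -/
theorem linearIndepOn_tightSet [FiniteDimensional ℝ V] {P : Set V} (hpoly : IsPolytope P)
    (hsimp : IsSimplicial P) {u : Dual ℝ V}
    (hu : u ∈ (polar (vertices P)).extremePoints ℝ) :
    LinearIndepOn ℝ id (tightSet (vertices P) u) := by
  rcases (tightSet (vertices P) u).eq_empty_or_nonempty with hemp | ⟨p, hp⟩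
  · rw [hemp]; exact linearIndepOn_empty ℝ id
  have hspan := span_tightSet_of_mem_extremePoints (finite_vertices hpoly) hu
  have huP : ∀ x ∈ P, u x ≤ 1 := by
    have := hu.1
    rwa [← polar_convexHull, convexHull_vertices hpoly] at this
  have hVP : vertices P ⊆ P := extremePoints_subset
  set F : Set V := {x ∈ P | u x = 1} with hF
  have htF : tightSet (vertices P) u ⊆ F := fun v hv => ⟨hVP hv.1, hv.2⟩
  have hpF : p ∈ F := htF hp
  have hexp : IsExposed ℝ P F := fun _ => ⟨LinearMap.toContinuousLinearMap u, by
    ext x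
    simp only [hF, Set.mem_ofPred_eq, LinearMap.coe_toContinuousLinearMap']
    refine and_congr_right fun hx => ⟨fun h y hy => h ▸ huP y hy, fun h => ?_⟩
    exact le_antisymm (huP x hx) (hpF.2 ▸ h p hpF.1)⟩
  have hle : vectorSpan ℝ F ≤ LinearMap.ker u := by
    rw [vectorSpan_def, Submodule.span_le]
    rintro _ ⟨x, hx, y, hy, rfl⟩
    simp [hx.2, hy.2]
  have hker : vectorSpan ℝ F = LinearMap.ker u := by
    apply le_antisymm hle
    · intro x hx
      have htop : Submodule.span ℝ (tightSet (vertices P) u) ≤ vectorSpan ℝ F ⊔ ℝ ∙ p := by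
        rw [Submodule.span_le]
        intro v hv
        have : v = (v - p) + p := by abel
        rw [this]
        exact Submodule.add_mem_sup (vsub_mem_vectorSpan ℝ (htF hv) hpF)
          (Submodule.mem_span_singleton_self p)
      have hx' : x ∈ vectorSpan ℝ F ⊔ ℝ ∙ p := htop (hspan ▸ trivial)
      obtain ⟨a, ha, c, hc, rfl⟩ := Submodule.mem_sup.mp hx'
      obtain ⟨t, rfl⟩ := Submodule.mem_span_singleton.mp hc
      have hua : u a = 0 := hle ha
      have : u (a + t • p) = 0 := hx
      rw [map_add, hua, map_smul, hp.2] at this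
      have ht : t = 0 := by simpa using this
      simpa [ht] using ha
  have hu0 : u ≠ 0 := by rintro rfl; simpa using hp.2
  have hfacet : IsFacet P F := ⟨hexp, ⟨p, hpF⟩, by
    rw [hker]; exact Module.Dual.finrank_ker_add_one_of_ne_zero hu0⟩
  obtain ⟨A, -, hA, hFA⟩ := hsimp F hfacet
  have htA : tightSet (vertices P) u ⊆ A := fun v hv => by
    have : v ∈ F.extremePoints ℝ :=
      inter_extremePoints_subset_extremePoints_of_subset (fun x hx => hx.1) ⟨htF hv, hv.1⟩
    rw [hFA] at this
    exact extremePoints_convexHull_subset this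
  have hind : AffineIndependent ℝ (fun x : tightSet (vertices P) u => (x : V)) :=
    hA.mono htA
  refine linearIndependent_iff'.mpr fun s w hw i hi => ?_
  refine affineIndependent_iff.mp hind s w ?_ hw i hi
  have := congrArg u hw
  simp only [map_sum, map_smul, map_zero, id] at this
  rw [← this]
  exact Finset.sum_congr rfl fun j _ => by rw [j.2.2, smul_eq_mul, mul_one]

/-- `W` carries no topology, so the compactness argument is run in coordinates. -/
theorem exists_mem_extremePoints {W : Type*} [AddCommGroup W] [Module ℝ W] [FiniteDimensional ℝ W]
    {K : Set W} (hK : IsPolytope K) (hne : K.Nonempty) : ∃ u, u ∈ K.extremePoints ℝ := by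
  obtain ⟨A, rfl⟩ := hK
  let e := (Module.finBasis ℝ W).equivFun
  have himg : e '' (convexHull ℝ (A : Set W)) = convexHull ℝ (e '' A) :=
    e.toLinearMap.image_convexHull A
  have hcomp : IsCompact (e '' (convexHull ℝ (A : Set W))) := by
    rw [himg]; exact (A.finite_toSet.image e).isCompact_convexHull (𝕜 := ℝ)
  obtain ⟨x, hx⟩ := hcomp.extremePoints_nonempty (hne.image e)
  rw [← image_extremePoints] at hx
  obtain ⟨u, hu, -⟩ := hx
  exact ⟨u, hu⟩

theorem vertices_nonempty_of_isReflexive {M : Submodule ℤ V} {P : Set V}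
    (hP : IsReflexive M P) : (vertices P).Nonempty := by
  have h0 : (0 : V) ∈ P := interior_subset hP.1.2.1
  rw [← convexHull_vertices hP.1.1.1] at h0
  exact convexHull_nonempty_iff.mp ⟨0, h0⟩

theorem dualPolytope_eq_polar_vertices {M : Submodule ℤ V} {P : Set V}
    (hP : IsReflexive M P) (hsymm : IsCentrallySymmetric P) :
    dualPolytope P = polar (vertices P) := by
  rw [dualPolytope_eq_polar hsymm, ← polar_convexHull (vertices P),
    convexHull_vertices hP.1.1.1]

theorem isReflexiveVertexSet_vertices [FiniteDimensional ℝ V] {M : Submodule ℤ V} {P : Set V}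
    (hP : IsReflexive M P) (hsimp : IsSimplicial P) (hsymm : IsCentrallySymmetric P) :
    IsReflexiveVertexSet (finite_vertices hP.1.1.1).toFinset (dualLattice M) := by
  have hpolar := dualPolytope_eq_polar_vertices hP hsymm
  refine ⟨fun v hv => ?_, fun h => ?_, fun u hu => ?_, fun y hy v hv => ?_, fun u hu => ?_⟩
  · rw [Set.Finite.mem_toFinset] at *
    exact neg_mem_vertices hsymm hv
  · rw [Set.Finite.mem_toFinset] at h
    exact (hP.1.2.2 0 h).2.1 rfl
  · rw [Set.Finite.coe_toFinset, ← hpolar] at hu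
    exact hP.2.2 hu
  · rw [Set.Finite.mem_toFinset] at hv
    exact hy v (hP.1.1.2 hv)
  · rw [Set.Finite.coe_toFinset] at *
    exact linearIndepOn_tightSet hP.1.1.1 hsimp hu

end Geometry

/-! ### The polytope attached to an involution, and its dual. -/

section Paired

variable {V : Type*} {J : Type*}

/-- The product of hexagons (one for each pair swapped by `τ`) and intervals (one for each fixed
point of `τ`). -/
def pairedPolytope (τ : J → J) : Set (J → ℝ) := {w | ∀ j, |w j| ≤ 1 ∧ w j - w (τ j) ≤ 1}

/-- The points `± p j` and `p j - p (τ j)`. -/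
def pairedVertices [AddCommGroup V] (p : J → V) (τ : J → J) : Set V :=
  {v | ∃ j, v = p j ∨ v = -p j ∨ (τ j ≠ j ∧ v = p j - p (τ j))}

theorem mem_polar_pairedVertices [AddCommGroup V] [Module ℝ V] {p : J → V} {τ : J → J}
    {y : Dual ℝ V} :
    y ∈ polar (pairedVertices p τ) ↔ (fun j => y (p j)) ∈ pairedPolytope τ := by
  constructor
  · refine fun h j => ⟨abs_le.mpr ⟨?_, h _ ⟨j, Or.inl rfl⟩⟩, ?_⟩
    · have := h _ ⟨j, Or.inr (Or.inl rfl)⟩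
      rw [map_neg] at this; linarith
    · by_cases hj : τ j = j
      · simp [hj]
      · simpa using h _ ⟨j, Or.inr (Or.inr ⟨hj, rfl⟩)⟩
  · rintro h v ⟨j, rfl | rfl | ⟨hj, rfl⟩⟩
    · exact (abs_le.mp (h j).1).2
    · rw [map_neg]; have := (abs_le.mp (h j).1).1
      dsimp only at this; linarith
    · rw [map_sub]; exact (h j).2

theorem mem_extremePoints_convexHull_of_forall_lt {V : Type*} [AddCommGroup V] [Module ℝ V]
    {A : Set V} {s : V} (hs : s ∈ A) (l : Dual ℝ V) (hl : ∀ t ∈ A, t ≠ s → l t < l s) :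
    s ∈ (convexHull ℝ A).extremePoints ℝ := by
  rw [(convex_convexHull ℝ A).mem_extremePoints_iff_mem_sdiff_convexHull_sdiff]
  refine ⟨subset_convexHull ℝ A hs, fun hmem => ?_⟩
  have hsub : convexHull ℝ A \ {s} ⊆ {x | l x < l s} := by
    rintro x ⟨hx, hxs⟩
    have hins : A ⊆ insert s {x | l x < l s} := fun t ht => by
      by_cases h : t = s
      · exact Or.inl h
      · exact Or.inr (hl t ht h)
    -- An open half-space together with one point of its boundary is still convex.
    have hconv : Convex ℝ (insert s {x | l x < l s}) := by
      have hhalf := convex_halfSpace_lt (𝕜 := ℝ) l.isLinear (l s)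
      intro x hx y hy a c ha hc hac
      rcases ha.eq_or_lt with rfl | ha'
      · rw [zero_add] at hac; subst hac; simpa using hy
      rcases hc.eq_or_lt with rfl | hc'
      · rw [add_zero] at hac; subst hac; simpa using hx
      rcases hx with rfl | hx
      · rcases hy with rfl | hy
        · left; rw [← add_smul, hac, one_smul]
        · right
          have hy : l y < l x := hy
          show l (a • x + c • y) < l x
          rw [map_add, map_smul, map_smul, smul_eq_mul, smul_eq_mul]
          have : c * l y < c * l x := mul_lt_mul_of_pos_left hy hc'
          have h2 : l x = a * l x + c * l x := by rw [← add_mul, hac, one_mul]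
          linarith
      · rcases hy with rfl | hy
        · right
          have hx : l x < l y := hx
          show l (a • x + c • y) < l y
          rw [map_add, map_smul, map_smul, smul_eq_mul, smul_eq_mul]
          have : a * l x < a * l y := mul_lt_mul_of_pos_left hx ha'
          have h2 : l y = a * l y + c * l y := by rw [← add_mul, hac, one_mul]
          linarith
        · exact Or.inr (hhalf hx hy ha hc hac)
    rcases convexHull_min hins hconv hx with h | h
    · exact absurd h hxs
    · exact h
  have hlt : l s < l s := convexHull_min hsub (convex_halfSpace_lt (𝕜 := ℝ) l.isLinear (l s)) hmem
  exact lt_irrefl _ hlt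

end Paired

section Paired

variable {V : Type*} [AddCommGroup V] [Module ℝ V] {J : Type*} {p : J → V} {q : J → Dual ℝ V}
  {τ : J → J}

theorem extremePoints_convexHull_pairedVertices [DecidableEq J]
    (hq : ∀ i j, q i (p j) = if i = j then 1 else 0) (hτ : Function.Involutive τ) :
    (convexHull ℝ (pairedVertices p τ)).extremePoints ℝ = pairedVertices p τ := by
  refine Set.Subset.antisymm extremePoints_convexHull_subset ?_
  have hτ' : ∀ i, τ (τ i) = i := hτ
  rintro s ⟨j, rfl | rfl | ⟨hj, rfl⟩⟩
  -- The unequal weights matter when `τ j ≠ j`: `q j` alone ties `p j` with `p j - p (τ j)`, and `q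
  -- j + q (τ j)` ties it with `p (τ j)`.
  · refine mem_extremePoints_convexHull_of_forall_lt ⟨j, Or.inl rfl⟩ (2 • q j + q (τ j)) ?_
    rintro t ⟨k, rfl | rfl | ⟨hk, rfl⟩⟩ hne <;>
      simp only [LinearMap.add_apply, LinearMap.smul_apply, map_neg, map_sub, hq, nsmul_eq_mul,
        Nat.cast_ofNat] <;> grind
  · refine mem_extremePoints_convexHull_of_forall_lt ⟨j, Or.inr (Or.inl rfl)⟩
      (-(2 • q j + q (τ j))) ?_
    rintro t ⟨k, rfl | rfl | ⟨hk, rfl⟩⟩ hne <;>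
      simp only [LinearMap.add_apply, LinearMap.smul_apply, map_neg, map_sub, hq, nsmul_eq_mul,
        Nat.cast_ofNat, LinearMap.neg_apply] <;> grind
  · refine mem_extremePoints_convexHull_of_forall_lt ⟨j, Or.inr (Or.inr ⟨hj, rfl⟩)⟩
      (q j - q (τ j)) ?_
    rintro t ⟨k, rfl | rfl | ⟨hk, rfl⟩⟩ hne <;>
      simp only [LinearMap.sub_apply, map_neg, map_sub, hq] <;> grind

theorem ncard_pairedVertices [DecidableEq J] [Fintype J]
    (hq : ∀ i j, q i (p j) = if i = j then 1 else 0) (hτ : Function.Involutive τ) :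
    (pairedVertices p τ).ncard = 2 * Fintype.card J + {j | τ j ≠ j}.ncard := by
  have hτ' : ∀ i, τ (τ i) = i := hτ
  set f : J ⊕ J ⊕ {j | τ j ≠ j} → V :=
    Sum.elim p (Sum.elim (fun j => -p j) fun j => p j - p (τ j)) with hf
  have hrange : pairedVertices p τ = Set.range f := by
    ext v
    constructor
    · rintro ⟨j, rfl | rfl | ⟨hj, rfl⟩⟩
      · exact ⟨Sum.inl j, rfl⟩
      · exact ⟨Sum.inr (Sum.inl j), rfl⟩
      · exact ⟨Sum.inr (Sum.inr ⟨j, hj⟩), rfl⟩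
    · rintro ⟨j | j | ⟨j, hj⟩, rfl⟩
      · exact ⟨j, Or.inl rfl⟩
      · exact ⟨j, Or.inr (Or.inl rfl)⟩
      · exact ⟨j, Or.inr (Or.inr ⟨hj, rfl⟩)⟩
  have hinj : Function.Injective f := by
    have hcoord : ∀ {a c}, f a = f c → ∀ i, q i (f a) = q i (f c) := fun h i => by rw [h]
    rintro (j | j | ⟨j, hj⟩) (k | k | ⟨k, hk⟩) h <;>
    · have hj1 := hcoord h j
      have hk1 := hcoord h k
      have hj2 := hcoord h (τ j)
      have hk2 := hcoord h (τ k)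
      simp only [hf, Sum.elim_inl, Sum.elim_inr, map_neg, map_sub, hq] at hj1 hk1 hj2 hk2
      grind
  rw [hrange, ← Set.image_univ, Set.ncard_image_of_injective _ hinj, Set.ncard_univ, Nat.card_sum,
    Nat.card_sum, Nat.card_eq_fintype_card, Nat.card_coe_set_eq]
  ring

end Paired

/-- An involution is a product of disjoint transpositions, so its cycle type, and hence its
conjugacy class, is determined by the number of moved points. -/
theorem exists_equiv_of_involutive {ι J : Type*} [Fintype ι] [Fintype J] {σ : ι → ι} {τ : J → J}
    (hσ : Function.Involutive σ) (hτ : Function.Involutive τ)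
    (hcard : Fintype.card ι = Fintype.card J)
    (hmoved : {i | σ i ≠ i}.ncard = {j | τ j ≠ j}.ncard) :
    ∃ g : ι ≃ J, ∀ i, g (σ i) = τ (g i) := by
  classical
  let g₀ := Fintype.equivOfCardEq hcard
  set s : Equiv.Perm J := (g₀.symm.trans hσ.toPerm).trans g₀ with hs
  set t : Equiv.Perm J := hτ.toPerm with ht
  have hs2 : s ^ 2 = 1 := by
    ext j; simp [hs, pow_two, hσ (g₀.symm j)]
  have ht2 : t ^ 2 = 1 := by
    ext j; simp [ht, pow_two, hτ j]
  have hsupp : s.support.card = t.support.card := by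
    rw [Set.ncard_eq_toFinset_card', Set.ncard_eq_toFinset_card'] at hmoved
    convert hmoved using 1
    · refine Finset.card_bij' (fun j _ => g₀.symm j) (fun i _ => g₀ i) ?_ ?_ ?_ ?_
      · intro j hj
        simpa [hs, ← Equiv.eq_symm_apply] using hj
      · intro i hi
        simpa [hs] using hi
      · simp
      · simp
    · congr 1; ext j; simp [ht]
  have hconj : IsConj s t := by
    rw [Equiv.Perm.isConj_iff_cycleType_eq]
    have : Fact (Nat.Prime 2) := ⟨Nat.prime_two⟩
    have h1 := Equiv.Perm.cycleType_of_pow_prime_eq_one hs2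
    have h2 := Equiv.Perm.cycleType_of_pow_prime_eq_one ht2
    have h3 := s.sum_cycleType
    have h4 := t.sum_cycleType
    rw [h1, Multiset.sum_replicate, smul_eq_mul] at h3
    rw [h2, Multiset.sum_replicate, smul_eq_mul] at h4
    rw [h1, h2]
    congr 1
    omega
  obtain ⟨c, hc⟩ := isConj_iff.mp hconj
  refine ⟨g₀.trans c, fun i => ?_⟩
  have : (c * s * c⁻¹) (c (g₀ i)) = t (c (g₀ i)) := by rw [hc]
  simpa [hs, ht] using this

/-! ### Hexagon powers as paired polytopes. -/

section Models

theorem mem_intLattice {x : ℝ} : x ∈ intLattice ↔ ∃ n : ℤ, x = n := by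
  rw [intLattice, Submodule.mem_span_singleton]
  simp [eq_comm]

theorem convex_pairedPolytope {J : Type*} (τ : J → J) : Convex ℝ (pairedPolytope τ) := by
  intro w hw z hz a c ha hc hac j
  have key : ∀ x y : ℝ, x ≤ 1 → y ≤ 1 → a * x + c * y ≤ 1 := fun x y hx hy => by
    have h1 := mul_le_mul_of_nonneg_left hx ha
    have h2 := mul_le_mul_of_nonneg_left hy hc
    linarith
  obtain ⟨hw1, hw2⟩ := hw j
  obtain ⟨hz1, hz2⟩ := hz j
  rw [abs_le] at hw1 hz1
  have h1 := key _ _ hw1.2 hz1.2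
  have h2 := key (-w j) (-z j) (by linarith) (by linarith)
  have h3 := key _ _ hw2 hz2
  simp only [Pi.add_apply, Pi.smul_apply, smul_eq_mul, abs_le]
  exact ⟨⟨by linarith, h1⟩, by linarith⟩

theorem mem_hexagon {w : Fin 2 → ℝ} :
    w ∈ hexagon ↔ w ∈ pairedPolytope (Fin.rev : Fin 2 → Fin 2) := by
  have hmem : w ∈ pairedPolytope (Fin.rev : Fin 2 → Fin 2) ↔
      ((-1 ≤ w 0 ∧ w 0 ≤ 1) ∧ w 0 - w 1 ≤ 1) ∧ ((-1 ≤ w 1 ∧ w 1 ≤ 1) ∧ w 1 - w 0 ≤ 1) := by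
    simp [pairedPolytope, Fin.forall_fin_two, abs_le]
  have hIcc : ∀ z : Fin 2 → ℝ, z ∈ Set.Icc (0 : Fin 2 → ℝ) 1 ∪ Set.Icc (-1) 0 ↔
      ((0 ≤ z 0 ∧ 0 ≤ z 1) ∧ z 0 ≤ 1 ∧ z 1 ≤ 1) ∨ ((-1 ≤ z 0 ∧ -1 ≤ z 1) ∧ z 0 ≤ 0 ∧ z 1 ≤ 0) := by
    intro z
    simp [Pi.le_def, Fin.forall_fin_two]
  rw [hmem]
  constructor
  · intro hw
    rw [← hmem]
    refine convexHull_min (fun z hz => ?_) (convex_pairedPolytope _) hw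
    rw [hIcc] at hz
    simp only [pairedPolytope, Set.mem_ofPred_eq, Fin.forall_fin_two, abs_le]
    rw [show Fin.rev (0 : Fin 2) = 1 from rfl, show Fin.rev (1 : Fin 2) = 0 from rfl]
    rcases hz with h | h <;> refine ⟨⟨⟨?_, ?_⟩, ?_⟩, ⟨⟨?_, ?_⟩, ?_⟩⟩ <;> linarith
  · rintro ⟨⟨⟨h1, h2⟩, h3⟩, ⟨h4, h5⟩, h6⟩
    -- For coordinates of opposite signs, `(a, c) = a (1, 0) + (1 - a) (0, r)` with `r = c / (1 -
    -- a)`. The inequality `a - c ≤ 1` gives `a < 1` and `r ≥ -1`.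
    have hmix : ∀ a c : ℝ, 0 < a → a ≤ 1 → c < 0 → -1 ≤ c → a - c ≤ 1 →
        ∃ r : ℝ, -1 ≤ r ∧ r ≤ 0 ∧ (1 - a) * r = c := by
      intro a c ha ha1 hc hc1 hac
      have ha2 : 0 < 1 - a := by linarith
      refine ⟨c / (1 - a), ?_, ?_, ?_⟩
      · rw [le_div_iff₀ ha2]; linarith
      · exact div_nonpos_of_nonpos_of_nonneg hc.le ha2.le
      · field_simp
    have hseg : ∀ (z z' : Fin 2 → ℝ) (a : ℝ), 0 < a → a ≤ 1 →
        z ∈ Set.Icc (0 : Fin 2 → ℝ) 1 ∪ Set.Icc (-1) 0 →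
        z' ∈ Set.Icc (0 : Fin 2 → ℝ) 1 ∪ Set.Icc (-1) 0 →
        w = a • z + (1 - a) • z' → w ∈ hexagon := by
      rintro z z' a ha ha1 hz hz' rfl
      exact convex_convexHull ℝ _ (subset_convexHull ℝ _ hz) (subset_convexHull ℝ _ hz') ha.le
        (by linarith) (by ring)
    rcases lt_or_ge 0 (w 0) with ha | ha <;> rcases lt_or_ge 0 (w 1) with hb | hb
    · exact subset_convexHull ℝ _ ((hIcc w).mpr (Or.inl ⟨⟨ha.le, hb.le⟩, h2, h5⟩))
    · rcases hb.eq_or_lt with hb | hb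
      · exact subset_convexHull ℝ _ ((hIcc w).mpr (Or.inl ⟨⟨ha.le, hb.ge⟩, h2, h5⟩))
      obtain ⟨r, hr1, hr2, hr⟩ := hmix (w 0) (w 1) ha h2 hb h4 h3
      refine hseg ![1, 0] ![0, r] (w 0) ha h2 ((hIcc _).mpr (Or.inl ?_))
        ((hIcc _).mpr (Or.inr ?_)) ?_
      · simp
      · simp [hr1, hr2]
      · ext j; fin_cases j <;> simp [hr]
    · rcases ha.eq_or_lt with ha | ha
      · exact subset_convexHull ℝ _ ((hIcc w).mpr (Or.inl ⟨⟨ha.ge, hb.le⟩, h2, h5⟩))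
      obtain ⟨r, hr1, hr2, hr⟩ := hmix (w 1) (w 0) hb h5 ha h1 h6
      refine hseg ![0, 1] ![r, 0] (w 1) hb h5 ((hIcc _).mpr (Or.inl ?_))
        ((hIcc _).mpr (Or.inr ?_)) ?_
      · simp
      · simp [hr1, hr2]
      · ext j; fin_cases j <;> simp [hr]
    · exact subset_convexHull ℝ _ ((hIcc w).mpr (Or.inr ⟨⟨h1, h4⟩, ha, hb⟩))

/-- The lattice `ℤ^J` in `ℝ^J`. -/
def integerLattice (J : Type*) : Submodule ℤ (J → ℝ) := Submodule.pi Set.univ fun _ => intLattice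

theorem mem_integerLattice {J : Type*} {w : J → ℝ} :
    w ∈ integerLattice J ↔ ∀ j, ∃ n : ℤ, w j = n := by
  simp [integerLattice, Submodule.mem_pi, mem_intLattice]

theorem isomorphic_iff_of_equiv {W X Y : Type*} [AddCommGroup W] [Module ℝ W] [AddCommGroup X]
    [Module ℝ X] [AddCommGroup Y] [Module ℝ Y] {L : Submodule ℤ W} {P : Set W}
    {L₁ : Submodule ℤ X} {P₁ : Set X} {L₂ : Submodule ℤ Y} {P₂ : Set Y} (φ : X ≃ₗ[ℝ] Y)
    (hL : ∀ x, φ x ∈ L₂ ↔ x ∈ L₁) (hP : ∀ x, φ x ∈ P₂ ↔ x ∈ P₁) :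
    Isomorphic L P L₁ P₁ ↔ Isomorphic L P L₂ P₂ := by
  have key : ∀ {A : Set W} {B : Set X} {C : Set Y} (e : W ≃ₗ[ℝ] X), (∀ x, φ x ∈ C ↔ x ∈ B) →
      (e '' A = B ↔ (e.trans φ) '' A = C) := by
    intro A B C e h
    have hC : C = φ '' B := by
      ext y
      obtain ⟨x, rfl⟩ := φ.surjective y
      rw [h, φ.injective.mem_set_image]
    have himg : (e.trans φ) '' A = φ '' (e '' A) := by
      rw [Set.image_image]; rfl
    rw [hC, himg]
    exact (φ.injective.image_injective.eq_iff).symm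
  constructor
  · rintro ⟨e, he, heP⟩
    exact ⟨e.trans φ, (key e hL).mp he, (key e hP).mp heP⟩
  · rintro ⟨e, he, heP⟩
    have : (e.trans φ.symm).trans φ = e := by ext; simp
    exact ⟨e.trans φ.symm, (key _ hL).mpr (by rw [this]; exact he),
      (key _ hP).mpr (by rw [this]; exact heP)⟩

/-- The involution exchanging the two coordinates of each of `k` planes. -/
def planeSwap (k : ℕ) : Fin k × Fin 2 → Fin k × Fin 2 := Prod.map id Fin.rev

/-- The involution exchanging the two coordinates of each of `k` planes, and fixing one further
coordinate. -/
def linePlaneSwap (k : ℕ) : Unit ⊕ Fin k × Fin 2 → Unit ⊕ Fin k × Fin 2 := Sum.map id (planeSwap k)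

theorem planeSwap_involutive (k : ℕ) : Function.Involutive (planeSwap k) := fun x => by
  simp [planeSwap, Prod.map]

theorem linePlaneSwap_involutive (k : ℕ) : Function.Involutive (linePlaneSwap k) := by
  rintro (x | x)
  · rfl
  · simp [linePlaneSwap, planeSwap_involutive k x]

theorem planeSwap_ne (k : ℕ) (x : Fin k × Fin 2) : planeSwap k x ≠ x := by
  obtain ⟨a, i⟩ := x
  fin_cases i <;> simp [planeSwap]

theorem ncard_planeSwap_ne (k : ℕ) : {x | planeSwap k x ≠ x}.ncard = 2 * k := by
  simp [planeSwap_ne, Set.ncard_univ, mul_comm]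

theorem ncard_linePlaneSwap_ne (k : ℕ) : {x | linePlaneSwap k x ≠ x}.ncard = 2 * k := by
  have : {x | linePlaneSwap k x ≠ x} = Sum.inr '' (Set.univ : Set (Fin k × Fin 2)) := by
    ext x
    rcases x with x | x <;> simp [linePlaneSwap, planeSwap_ne]
  rw [this, Set.ncard_image_of_injective _ Sum.inr_injective, Set.ncard_univ]
  simp [mul_comm]

theorem curry_mem_planeLatticePow {k : ℕ} {w : Fin k × Fin 2 → ℝ} :
    LinearEquiv.curry ℝ ℝ (Fin k) (Fin 2) w ∈ planeLatticePow k ↔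
      w ∈ integerLattice (Fin k × Fin 2) := by
  simp [planeLatticePow, planeLattice, integerLattice, Submodule.mem_pi, Prod.forall,
    Function.curry]

theorem curry_mem_hexagonPow {k : ℕ} {w : Fin k × Fin 2 → ℝ} :
    LinearEquiv.curry ℝ ℝ (Fin k) (Fin 2) w ∈ hexagonPow k ↔ w ∈ pairedPolytope (planeSwap k) := by
  simp only [hexagonPow, Set.mem_univ_pi, mem_hexagon]
  simp [pairedPolytope, planeSwap, Function.curry]

variable {W : Type*} [AddCommGroup W] [Module ℝ W] {L : Submodule ℤ W} {P : Set W}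

theorem isomorphic_hexagonPow_iff (k : ℕ) :
    Isomorphic L P (integerLattice (Fin k × Fin 2)) (pairedPolytope (planeSwap k)) ↔
      Isomorphic L P (planeLatticePow k) (hexagonPow k) :=
  isomorphic_iff_of_equiv (LinearEquiv.curry ℝ ℝ (Fin k) (Fin 2))
    (fun _ => curry_mem_planeLatticePow) fun _ => curry_mem_hexagonPow

theorem isomorphic_segment_prod_hexagonPow_iff (k : ℕ) :
    Isomorphic L P (integerLattice (Unit ⊕ Fin k × Fin 2)) (pairedPolytope (linePlaneSwap k)) ↔
      Isomorphic L P (intLattice.prod (planeLatticePow k))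
        (Set.Icc (-1 : ℝ) 1 ×ˢ hexagonPow k) := by
  refine isomorphic_iff_of_equiv
    ((LinearEquiv.sumArrowLequivProdArrow Unit (Fin k × Fin 2) ℝ ℝ).trans
      (LinearEquiv.prodCongr (LinearEquiv.funUnique Unit ℝ ℝ)
        (LinearEquiv.curry ℝ ℝ (Fin k) (Fin 2)))) (fun w => ?_) fun w => ?_
  · rw [LinearEquiv.trans_apply, LinearEquiv.prodCongr_apply, Submodule.mem_prod,
      curry_mem_planeLatticePow]
    simp [integerLattice, Submodule.mem_pi, Unique.forall_iff]
  · rw [LinearEquiv.trans_apply, LinearEquiv.prodCongr_apply, Set.mem_prod,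
      curry_mem_hexagonPow]
    simp [pairedPolytope, linePlaneSwap, abs_le, Unique.forall_iff]

end Models

/-! ### The bound and the equality case. -/

section Main

variable {V : Type*} [NormedAddCommGroup V] [NormedSpace ℝ V] [FiniteDimensional ℝ V]
  {M : Submodule ℤ V} {P : Set V}

theorem finrank_pos_of_isReflexive (hP : IsReflexive M P) : 0 < finrank ℝ V := by
  obtain ⟨v, hv⟩ := vertices_nonempty_of_isReflexive hP
  have hv0 := (hP.1.2.2 v hv).2.1
  have : Nontrivial V := ⟨v, 0, hv0⟩
  exact finrank_pos

/-- A facet of `P`, given by a vertex `u` of the dual polytope, whose vertices form a basis. -/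
theorem exists_facet_basis (hP : IsReflexive M P) (hsimp : IsSimplicial P)
    (hsymm : IsCentrallySymmetric P) :
    ∃ u ∈ (polar ((finite_vertices hP.1.1.1).toFinset : Set V)).extremePoints ℝ,
    ∃ b : Basis (Fin (finrank ℝ V)) ℝ V,
      Set.range b = tightSet ((finite_vertices hP.1.1.1).toFinset : Set V) u := by
  have hne : (dualPolytope P).Nonempty := ⟨0, fun x _ => by simp⟩
  obtain ⟨u, hu⟩ := exists_mem_extremePoints hP.2.1 hne
  rw [dualPolytope_eq_polar_vertices hP hsymm, ← (finite_vertices hP.1.1.1).coe_toFinset] at hu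
  obtain ⟨b, hb⟩ := (isReflexiveVertexSet_vertices hP hsimp hsymm).exists_basis hu
  have : Fintype (tightSet ((finite_vertices hP.1.1.1).toFinset : Set V) u) :=
    FiniteDimensional.fintypeBasisIndex b
  let g := Fintype.equivFinOfCardEq (finrank_eq_card_basis b).symm
  refine ⟨u, hu, b.reindex g, ?_⟩
  rw [Basis.range_reindex, funext hb, Subtype.range_coe]

theorem ncard_vertices_le (hP : IsReflexive M P) (hsimp : IsSimplicial P)
    (hsymm : IsCentrallySymmetric P) :
    ∃ n, (vertices P).ncard = 2 * finrank ℝ V + n ∧ Even n ∧ n ≤ finrank ℝ V := by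
  obtain ⟨u, hu, b, hb⟩ := exists_facet_basis hP hsimp hsymm
  have h := isReflexiveVertexSet_vertices hP hsimp hsymm
  refine ⟨_, ?_, h.even_card_equator u, ?_⟩
  · rw [Set.ncard_eq_toFinset_card _ (finite_vertices hP.1.1.1), h.card_eq hu hb, Fintype.card_fin]
  · simpa using h.card_equator_le hu.1 hb

variable {J : Type*} [Fintype J] {τ : J → J}

theorem isomorphic_of_ncard_vertices (hP : IsReflexive M P) (hsimp : IsSimplicial P)
    (hsymm : IsCentrallySymmetric P) (hτ : Function.Involutive τ)
    (hcard : finrank ℝ V = Fintype.card J)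
    (hmoved : Fintype.card J ≤ {j | τ j ≠ j}.ncard + 1)
    (hn : (vertices P).ncard = 2 * Fintype.card J + {j | τ j ≠ j}.ncard) :
    Isomorphic (dualLattice M) (dualPolytope P) (integerLattice J) (pairedPolytope τ) := by
  obtain ⟨u, hu, b, hb⟩ := exists_facet_basis hP hsimp hsymm
  have h := isReflexiveVertexSet_vertices hP hsimp hsymm
  rw [Set.ncard_eq_toFinset_card _ (finite_vertices hP.1.1.1), h.card_eq hu hb, Fintype.card_fin,
    hcard, Nat.add_left_cancel_iff] at hn
  obtain ⟨σ, hσ, hσcard, hS, hN⟩ := h.exists_involution hu hb (by rw [Fintype.card_fin]; omega)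
  obtain ⟨g, hg⟩ := exists_equiv_of_involutive hσ hτ (by rw [Fintype.card_fin, hcard])
    (hσcard.trans hn)
  -- Evaluation on the facet basis, relabelled so that `σ` becomes `τ`; `hN` says that it carries
  -- the dual lattice onto `ℤ^J`.
  set e : Dual ℝ V ≃ₗ[ℝ] (J → ℝ) := ((b.reindex g).constr ℝ).symm with he
  have hev : ∀ y j, e y j = y (b (g.symm j)) := fun y j => by
    simp [he]
  have hV : vertices P = pairedVertices b σ := by
    ext v
    rw [← (finite_vertices hP.1.1.1).mem_toFinset, hS]
    rfl
  have himage : ∀ {A : Set (Dual ℝ V)} {B : Set (J → ℝ)}, (∀ y, y ∈ A ↔ e y ∈ B) → e '' A = B := by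
    intro A B hAB
    ext w
    obtain ⟨y, rfl⟩ := e.surjective w
    rw [e.injective.mem_set_image, hAB]
  refine ⟨e, himage fun y => ?_, himage fun y => ?_⟩
  · rw [SetLike.mem_coe, SetLike.mem_coe, hN, mem_integerLattice, ← g.symm.forall_congr_right]
    simp only [hev]
  · rw [dualPolytope_eq_polar_vertices hP hsymm, hV, mem_polar_pairedVertices]
    have hgs : ∀ j, g.symm (τ j) = σ (g.symm j) := fun j => by
      rw [Equiv.symm_apply_eq, hg, Equiv.apply_symm_apply]
    simp only [pairedPolytope, Set.mem_ofPred_eq, hev, hgs]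
    exact (g.symm.forall_congr_right (q := fun i => |y (b i)| ≤ 1 ∧ y (b i) - y (b (σ i)) ≤ 1)).symm

/-- The polar of `P` determines `P`, so `P` is the hull of the paired points, all of which are
vertices. Only the linear isomorphism of polytopes is needed, not its action on the lattices. -/
theorem ncard_vertices_of_isomorphic (hP : IsReflexive M P) (hsymm : IsCentrallySymmetric P)
    (hτ : Function.Involutive τ) (hcard : finrank ℝ V = Fintype.card J)
    (hiso : Isomorphic (dualLattice M) (dualPolytope P) (integerLattice J) (pairedPolytope τ)) :
    (vertices P).ncard = 2 * Fintype.card J + {j | τ j ≠ j}.ncard := by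
  classical
  obtain ⟨e, -, he⟩ := hiso
  -- By biduality, the coordinates of `e` are evaluations at points `p j` of `V`.
  set p : J → V := fun j => (evalEquiv ℝ V).symm ((LinearMap.proj j).comp e.toLinearMap) with hp
  have hyp : ∀ (y : Dual ℝ V) j, y (p j) = e y j := fun y j => by
    simp [hp]
  have hq : ∀ i j, e.symm (Pi.single i 1) (p j) = if i = j then 1 else 0 := fun i j => by
    rw [hyp, e.apply_symm_apply, Pi.single_apply]
    simp only [eq_comm]
  have hpolar : polar (vertices P) = polar (pairedVertices p τ) := by
    rw [← dualPolytope_eq_polar_vertices hP hsymm]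
    ext y
    rw [mem_polar_pairedVertices, ← he, ← e.injective.mem_set_image]
    simp only [hyp]
  have hpoly : IsPolytope (convexHull ℝ (pairedVertices p τ)) := by
    have hfin : (pairedVertices p τ).Finite := by
      have : pairedVertices p τ ⊆
          Set.range p ∪ Set.range (fun j => -p j) ∪ Set.range fun j => p j - p (τ j) := by
        rintro v ⟨j, rfl | rfl | ⟨-, rfl⟩⟩
        · exact Or.inl (Or.inl ⟨j, rfl⟩)
        · exact Or.inl (Or.inr ⟨j, rfl⟩)
        · exact Or.inr ⟨j, rfl⟩
      exact (((Set.finite_range _).union (Set.finite_range _)).union (Set.finite_range _)).subset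
        this
    exact ⟨hfin.toFinset, by rw [hfin.coe_toFinset]⟩
  have hVP := convexHull_vertices hP.1.1.1
  have h0 : (0 : V) ∈ convexHull ℝ (pairedVertices p τ) := by
    have hpos := finrank_pos_of_isReflexive hP
    rw [hcard, Fintype.card_pos_iff] at hpos
    obtain ⟨j⟩ := hpos
    have := convex_convexHull ℝ (pairedVertices p τ)
      (subset_convexHull ℝ _ ⟨j, Or.inl rfl⟩) (subset_convexHull ℝ _ ⟨j, Or.inr (Or.inl rfl)⟩)
      (by norm_num : (0 : ℝ) ≤ 1 / 2) (by norm_num : (0 : ℝ) ≤ 1 / 2) (by norm_num)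
    rwa [smul_neg, add_neg_cancel] at this
  have hPeq : P = convexHull ℝ (pairedVertices p τ) := by
    rw [← hVP]
    apply Set.Subset.antisymm
    · refine subset_of_polar_subset (convex_convexHull ℝ _) (isClosed_of_isPolytope hpoly) h0 ?_
      rw [polar_convexHull, polar_convexHull, hpolar]
    · refine subset_of_polar_subset (convex_convexHull ℝ _) ?_ ?_ ?_
      · rw [hVP]; exact isClosed_of_isPolytope hP.1.1.1
      · rw [hVP]; exact interior_subset hP.1.2.1
      · rw [polar_convexHull, polar_convexHull, hpolar]
  have hvert : vertices P = pairedVertices p τ := by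
    rw [hPeq]; exact extremePoints_convexHull_pairedVertices hq hτ
  rw [hvert, ncard_pairedVertices hq hτ]

/-- The condition `hmoved` says that `τ` has at most one fixed point; this covers both parities of
the dimension. -/
theorem ncard_vertices_eq_iff (hP : IsReflexive M P) (hsimp : IsSimplicial P)
    (hsymm : IsCentrallySymmetric P) (hτ : Function.Involutive τ)
    (hcard : finrank ℝ V = Fintype.card J)
    (hmoved : Fintype.card J ≤ {j | τ j ≠ j}.ncard + 1) :
    (vertices P).ncard = 2 * Fintype.card J + {j | τ j ≠ j}.ncard ↔
      Isomorphic (dualLattice M) (dualPolytope P) (integerLattice J) (pairedPolytope τ) :=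
  ⟨isomorphic_of_ncard_vertices hP hsimp hsymm hτ hcard hmoved,
    ncard_vertices_of_isomorphic hP hsymm hτ hcard⟩

end Main

end LatticePolytope

theorem theorem5p6 {V : Type*} [NormedAddCommGroup V] [NormedSpace ℝ V] [FiniteDimensional ℝ V]
    (M : Submodule ℤ V) [DiscreteTopology M] [IsZLattice ℝ M]
    (d : ℕ) (hd : Module.finrank ℝ V = d)
    (P : Set V) (hP : LatticePolytope.IsReflexive M P)
    (hsimp : LatticePolytope.IsSimplicial P) (hsymm : LatticePolytope.IsCentrallySymmetric P) :
    (Even d →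
      (LatticePolytope.vertices P).ncard ≤ 3 * d ∧
      ((LatticePolytope.vertices P).ncard = 3 * d ↔
        LatticePolytope.Isomorphic
          (LatticePolytope.dualLattice M) (LatticePolytope.dualPolytope P)
          (LatticePolytope.planeLatticePow (d / 2)) (LatticePolytope.hexagonPow (d / 2)))) ∧
    (Odd d →
      (LatticePolytope.vertices P).ncard ≤ 3 * d - 1 ∧
      ((LatticePolytope.vertices P).ncard = 3 * d - 1 ↔
        LatticePolytope.Isomorphic
          (LatticePolytope.dualLattice M) (LatticePolytope.dualPolytope P)
          (LatticePolytope.intLattice.prod (LatticePolytope.planeLatticePow ((d - 1) / 2)))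
          (Set.Icc (-1 : ℝ) 1 ×ˢ LatticePolytope.hexagonPow ((d - 1) / 2)))) := by

  obtain ⟨n, hn, heven, hle⟩ := LatticePolytope.ncard_vertices_le hP hsimp hsymm
  rw [hd] at hn hle
  refine ⟨fun hdE => ⟨by omega, ?_⟩, fun hdO => ⟨?_, ?_⟩⟩
  · obtain ⟨k, rfl⟩ := hdE
    have hk : (k + k) / 2 = k := by omega
    have hmoved := LatticePolytope.ncard_planeSwap_ne k
    have hcard : Fintype.card (Fin k × Fin 2) = 2 * k := by simp [mul_comm]
    rw [hk, ← LatticePolytope.isomorphic_hexagonPow_iff,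
      ← LatticePolytope.ncard_vertices_eq_iff hP hsimp hsymm
        (LatticePolytope.planeSwap_involutive k) (by omega) (by omega), hmoved, hcard]
    omega
  -- An even `n ≤ d` with `d` odd satisfies `n ≤ d - 1`. Since `d` is positive, the truncated
  -- subtraction `3 * d - 1` is the true one.
  · obtain ⟨k, rfl⟩ := hdO
    obtain ⟨m, rfl⟩ := heven
    omega
  · obtain ⟨k, rfl⟩ := hdO
    have hk : (2 * k + 1 - 1) / 2 = k := by omega
    have hmoved := LatticePolytope.ncard_linePlaneSwap_ne k
    have hcard : Fintype.card (Unit ⊕ Fin k × Fin 2) = 2 * k + 1 := by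
      simp [mul_comm, add_comm]
    rw [hk, ← LatticePolytope.isomorphic_segment_prod_hexagonPow_iff,
      ← LatticePolytope.ncard_vertices_eq_iff hP hsimp hsymm
        (LatticePolytope.linePlaneSwap_involutive k) (by omega) (by omega), hmoved, hcard]
    omega
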